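/- Let $\|\cdot\|$ be an arbitrary norm on $\mathbb{R}^m$, let $\Xi\subseteq\mathbb{R}^m$ be convex and closed, let $N,K\ge 1$, let $\hat\xi_1,\dots,\hat\xi_N\in\Xi$, let $\varepsilon\ge 0$, and let $\ell_1,\dots,\ell_K:\mathbb{R}^m\to[-\infty,\infty]$ be such that each $-\ell_k$ is proper, convex and lower semicontinuous and no $\ell_k$ is identically $-\infty$ on $\Xi$. Put $\ell=\max_{k\le K}\ell_k$ and $\hat P_N=\frac1N\sum_{i=1}^N\delta_{\hat\xi_i}$. Let $\mathcal M(\Xi)$ be the set of probability distributions $Q$ supported on $\Xi$ with $\mathbb{E}^Q[\|\xi\|]<\infty$, let $$d_W(Q_1,Q_2)=\inf\Big\{\int\|\xi_1-\xi_2\|\,\Pi(d\xi_1,d\xi_2)\;:\;\Pi\text{ has marginals }Q_1,Q_2\Big\},$$ let $\mathbb{B}_\varepsilon(\hat P_N)=\{Q\in\mathcal M(\Xi): d_W(\hat P_N,Q)\le\varepsilon\}$, and consider the worst-case expectation $$\sup_{Q\in\mathbb{B}_\varepsilon(\hat P_N)}\mathbb{E}^Q[\ell(\xi)],\qquad(1)$$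 where $\mathbb{E}^Q[\ell]=\mathbb{E}^Q[\max\{\ell,0\}]+\mathbb{E}^Q[\min\{\ell,0\}]$ with $\infty-\infty=\infty$. Consider also the finite program $$\sup_{\alpha_{ik}\in\mathbb{R},\;q_{ik}\in\mathbb{R}^m}\ \frac1N\sum_{i=1}^N\sum_{k=1}^K\alpha_{ik}\,\ell_k\Big(\hat\xi_i-\frac{q_{ik}}{\alpha_{ik}}\Big)\qquad(2)$$ subject to $\frac1N\sum_{i,k}\|q_{ik}\|\le\varepsilon$, $\sum_{k}\alpha_{ik}=1$ for all $i$, and $\alpha_{ik}\ge0$, $\hat\xi_i-q_{ik}/\alpha_{ik}\in\Xi$ for all $i,k$. Here $0\cdot(-\infty)=0$ and $0/0=0$, and if $\alpha_{ik}=0\neq q_{ik}$, then the last constraint counts as violated. Suppose that $\Xi$ is compact or that $K=1$ (so that $\ell$ is concave). Then there are sequences $\{\alpha_{ik}(r),q_{ik}(r)\}_{r\in\mathbb{N}}$ of feasible decisions of (2) whose objective values converge (in $[-\infty,\infty]$) to the supremum of (2). For every such sequence, with $\xi_{ik}(r)=\hat\xi_i-q_{ik}(r)/\alpha_{ik}(r)$,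 the sequence $\{\alpha_{ik}(r),\xi_{ik}(r)\}_{r\in\mathbb{N}}$ has an accumulation point, and for each of its accumulation points $\{\alpha^\star_{ik},\xi^\star_{ik}\}$ the distribution $$Q^\star=\frac1N\sum_{i=1}^N\sum_{k=1}^K\alpha^\star_{ik}\,\delta_{\xi^\star_{ik}}$$ belongs to $\mathbb{B}_\varepsilon(\hat P_N)$ and attains the supremum in (1). -/

import Mathlib

noncomputable section

namespace WassersteinDRO

open MeasureTheory Filter Topology
open scoped ENNReal

variable {E : Type*} [NormedAddCommGroup E] [NormedSpace ℝ E]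

/-! ### Extended-real-valued convex functions -/

/-- A function is proper if it is below `+∞` at some point and never takes the value `-∞`. -/
def IsProper (f : E → EReal) : Prop :=
  (∃ x, f x < ⊤) ∧ ∀ x, ⊥ < f x

/-- An extended-real-valued function is convex if its epigraph is a convex set. -/
def IsConvexFun (f : E → EReal) : Prop :=
  Convex ℝ {p : E × ℝ | f p.1 ≤ (p.2 : EReal)}

/-- The convexity assumption: `Ξ` is convex and closed, every `-ℓ k` is proper, convex and lower
semicontinuous, and no `ℓ k` is identically `-∞` on `Ξ`. -/
structure ConvexityAssumption (Ξ : Set E) {K : ℕ} (ℓ : Fin K → E → EReal) : Prop where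
  convex_set : Convex ℝ Ξ
  closed_set : IsClosed Ξ
  proper : ∀ k, IsProper (fun x => -ℓ k x)
  convex : ∀ k, IsConvexFun (fun x => -ℓ k x)
  lsc : ∀ k, LowerSemicontinuous (fun x => -ℓ k x)
  not_bot : ∀ k, ∃ x ∈ Ξ, ℓ k x ≠ ⊥

/-- The loss `ℓ = max_k ℓ k`. -/
def loss {K : ℕ} (ℓ : Fin K → E → EReal) (x : E) : EReal := ⨆ k, ℓ k x

/-! ### Distributions, Wasserstein distance, worst-case expectation -/

section Measures

variable [MeasurableSpace E]

/-- The distributions supported on `Ξ` with finite first moment. -/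
def distributions (Ξ : Set E) : Set (Measure E) :=
  {Q | IsProbabilityMeasure Q ∧ Q Ξᶜ = 0 ∧ ∫⁻ x, ‖x‖ₑ ∂Q < ⊤}

/-- The joint distributions with marginals `Q₁` and `Q₂`. -/
def couplings (Q₁ Q₂ : Measure E) : Set (Measure (E × E)) :=
  {P | P.map Prod.fst = Q₁ ∧ P.map Prod.snd = Q₂}

/-- The (1-)Wasserstein distance with respect to the norm of `E`. -/
def wasserstein (Q₁ Q₂ : Measure E) : ℝ≥0∞ :=
  ⨅ P ∈ couplings Q₁ Q₂, ∫⁻ z, ‖z.1 - z.2‖ₑ ∂P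

/-- The uniform distribution on the `N` data points. -/
def empirical {N : ℕ} (data : Fin N → E) : Measure E :=
  (N : ℝ≥0∞)⁻¹ • ∑ i, Measure.dirac (data i)

/-- The Wasserstein ball of radius `ε` around the empirical distribution, within the
distributions on `Ξ`. -/
def ball (Ξ : Set E) {N : ℕ} (data : Fin N → E) (ε : ℝ) : Set (Measure E) :=
  {Q | Q ∈ distributions Ξ ∧ wasserstein (empirical data) Q ≤ ENNReal.ofReal ε}

open Classical in
/-- The expectation `E[max(f,0)] + E[min(f,0)]` in the extended reals, with the convention
`∞ - ∞ = ∞`. -/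
def expectation (Q : Measure E) (f : E → EReal) : EReal :=
  if ∫⁻ x, (f x).toENNReal ∂Q = ⊤ then ⊤
  else ((∫⁻ x, (f x).toENNReal ∂Q : ℝ≥0∞) : EReal) - ((∫⁻ x, (-f x).toENNReal ∂Q : ℝ≥0∞) : EReal)

/-- The worst-case expectation of the loss over the Wasserstein ball. -/
def worstCaseExpectation (Ξ : Set E) {N K : ℕ} (data : Fin N → E) (ε : ℝ)
    (ℓ : Fin K → E → EReal) : EReal :=
  ⨆ Q ∈ ball Ξ data ε, expectation Q (loss ℓ)

/-- The discrete distribution `(1/N) ∑ i, ∑ k, α i k • δ_(ξ i k)`. -/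
def discreteDistribution {N K : ℕ} (α : Fin N → Fin K → ℝ) (ξ : Fin N → Fin K → E) :
    Measure E :=
  (N : ℝ≥0∞)⁻¹ • ∑ i, ∑ k, ENNReal.ofReal (α i k) • Measure.dirac (ξ i k)

end Measures

/-! ### The finite convex program -/

/-- The atoms `ξ i k = data i - q i k / α i k`, with `0 / 0 = 0`. -/
def atoms {N K : ℕ} (data : Fin N → E) (α : Fin N → Fin K → ℝ) (q : Fin N → Fin K → E) :
    Fin N → Fin K → E :=
  fun i k => data i - (α i k)⁻¹ • q i k

/-- The feasible decisions `(α, q)`. If `α i k = 0` and `q i k ≠ 0`, then `q i k / α i k` has an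
infinite component and `data i - q i k / α i k` is not in `Ξ`: this is the condition `zero`. -/
structure Feasible (Ξ : Set E) {N K : ℕ} (data : Fin N → E) (ε : ℝ)
    (α : Fin N → Fin K → ℝ) (q : Fin N → Fin K → E) : Prop where
  budget : (1 / (N : ℝ)) * ∑ i, ∑ k, ‖q i k‖ ≤ ε
  sum_one : ∀ i, ∑ k, α i k = 1
  nonneg : ∀ i k, 0 ≤ α i k
  zero : ∀ i k, α i k = 0 → q i k = 0
  mem : ∀ i k, atoms data α q i k ∈ Ξ

/-- The objective `(1/N) ∑ i, ∑ k, α i k * ℓ k (data i - q i k / α i k)`, with `0 * (-∞) = 0`. -/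
def objective {N K : ℕ} (data : Fin N → E) (ℓ : Fin K → E → EReal)
    (α : Fin N → Fin K → ℝ) (q : Fin N → Fin K → E) : EReal :=
  ((1 / (N : ℝ) : ℝ) : EReal) * ∑ i, ∑ k, ((α i k : ℝ) : EReal) * ℓ k (atoms data α q i k)

/-- The optimal value of the finite convex program. -/
def optimalValue (Ξ : Set E) {N K : ℕ} (data : Fin N → E) (ε : ℝ)
    (ℓ : Fin K → E → EReal) : EReal :=
  sSup {v | ∃ α q, Feasible Ξ data ε α q ∧ objective data ℓ α q = v}

/-- A sequence of feasible decisions whose objective values converge to the optimal value. -/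
def IsMaximizing (Ξ : Set E) {N K : ℕ} (data : Fin N → E) (ε : ℝ) (ℓ : Fin K → E → EReal)
    (α : ℕ → Fin N → Fin K → ℝ) (q : ℕ → Fin N → Fin K → E) : Prop :=
  (∀ r, Feasible Ξ data ε (α r) (q r)) ∧
    Tendsto (fun r => objective data ℓ (α r) (q r)) atTop (𝓝 (optimalValue Ξ data ε ℓ))

end WassersteinDRO

end

noncomputable section

namespace WassersteinDRO

open MeasureTheory Filter Topology
open scoped ENNReal

/-! ### Sums and upper limits in the extended reals -/

/-! The program is studied in the variables `(α, ξ)` of `AtomFeasible`, where budget and constraints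
are continuous; the quotient `q / α` is not continuous at `α = 0`.

Upper bound (`expectation_le_optimalValue`): for `Q` in the ball, disintegrating a nearly optimal
coupling writes `Q` as the mean of laws `ν i`, one per data point. Cut the space into cells `A k` on
which the loss equals `ℓ k`, and collapse each `ν i` on each `A k` to its barycenter. Convexity of
the norm keeps the cost within budget, convexity of `Ξ` keeps the atoms in `Ξ`, and Jensen for the
concave `ℓ k` does not lower the value. This bounds the expectation by the optimal value at every
budget `ε' > ε`; right-continuity in the budget (`le_optimalValue_of_forall`) gives the bound at
`ε`.

Attainment: the case assumption confines the atoms to a compact set, so accumulation points exist.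
They are feasible (`AtomFeasible.of_tendsto`), and by upper semicontinuity their weighted loss is at
least the optimal value. Since `ℓ k ≤ loss ℓ`, the expectation under `Q⋆` is no smaller, and `Q⋆`
lies in the ball, so all these quantities coincide. -/

lemma ereal_coe_sum {ι : Type*} (s : Finset ι) (f : ι → ℝ) :
    ((∑ i ∈ s, f i : ℝ) : EReal) = ∑ i ∈ s, (f i : EReal) := by
  classical
  induction s using Finset.induction_on with
  | empty => simp
  | insert a s ha ih => rw [Finset.sum_insert ha, Finset.sum_insert ha, EReal.coe_add, ih]

lemma ereal_sum_lt_top {ι : Type*} (s : Finset ι) {f : ι → EReal} (h : ∀ i ∈ s, f i < ⊤) :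
    ∑ i ∈ s, f i < ⊤ := by
  classical
  induction s using Finset.induction_on with
  | empty => simp
  | insert a s ha ih =>
    rw [Finset.sum_insert ha]
    exact EReal.add_lt_top (h a (Finset.mem_insert_self a s)).ne
      (ih fun i hi => h i (Finset.mem_insert_of_mem hi)).ne

lemma ereal_sum_eq_bot {ι : Type*} (s : Finset ι) {f : ι → EReal} {i : ι} (hi : i ∈ s)
    (h : f i = ⊥) : ∑ i ∈ s, f i = ⊥ := by
  classical
  rw [← Finset.add_sum_erase s f hi, h, EReal.bot_add]

lemma coe_mul_lt_top {a : ℝ} (ha : 0 ≤ a) {x : EReal} (hx : x < ⊤) : (a : EReal) * x < ⊤ := by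
  induction x with
  | bot =>
    rcases ha.eq_or_lt with rfl | h
    · simp
    · rw [EReal.coe_mul_bot_of_pos h]; exact bot_lt_top
  | coe x => rw [← EReal.coe_mul]; exact EReal.coe_lt_top _
  | top => exact absurd hx (lt_irrefl _)

lemma limsup_sum_le {ι : Type*} (s : Finset ι) {u : ι → ℕ → EReal} {a : ι → EReal}
    (ha : ∀ i ∈ s, a i < ⊤) (h : ∀ i ∈ s, limsup (u i) atTop ≤ a i) :
    limsup (fun r => ∑ i ∈ s, u i r) atTop ≤ ∑ i ∈ s, a i := by
  classical
  induction s using Finset.induction_on with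
  | empty => simp
  | insert j s hj ih =>
    have h1 := h j (Finset.mem_insert_self j s)
    have h2 := ih (fun i hi => ha i (Finset.mem_insert_of_mem hi))
      fun i hi => h i (Finset.mem_insert_of_mem hi)
    have t1 : limsup (u j) atTop < ⊤ := h1.trans_lt (ha j (Finset.mem_insert_self j s))
    have t2 : limsup (fun r => ∑ i ∈ s, u i r) atTop < ⊤ :=
      h2.trans_lt (ereal_sum_lt_top s fun i hi => ha i (Finset.mem_insert_of_mem hi))
    simp only [Finset.sum_insert hj]
    exact (EReal.limsup_add_le (Or.inr t2.ne) (Or.inl t1.ne)).trans (add_le_add h1 h2)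

/-- Products of convergent nonnegative weights with an upper semicontinuous function are upper
semicontinuous along sequences. -/
lemma limsup_coe_mul_le {X : Type*} [TopologicalSpace X] {f : X → EReal}
    (hf : UpperSemicontinuous f) (htop : ∀ x, f x < ⊤) {a : ℕ → ℝ} {x : ℕ → X} {a₀ : ℝ} {x₀ : X}
    (ha : ∀ r, 0 ≤ a r) (hlim : Tendsto a atTop (𝓝 a₀)) (hx : Tendsto x atTop (𝓝 x₀)) :
    limsup (fun r => (a r : EReal) * f (x r)) atTop ≤ (a₀ : EReal) * f x₀ := by
  -- Near `x₀` the function stays below `c`. Optimizing over `c` then suffices: if `a₀ = 0` any real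
  -- `c` gives the bound `0`, even when `f x₀ = ⊥`; otherwise take `c = z / a₀` with `z` above the
  -- target.
  have key : ∀ c : ℝ, f x₀ < c →
      limsup (fun r => (a r : EReal) * f (x r)) atTop ≤ ((a₀ * c : ℝ) : EReal) := by
    intro c hc
    have h1 : ∀ᶠ r in atTop, (a r : EReal) * f (x r) ≤ ((a r * c : ℝ) : EReal) := by
      filter_upwards [hx.eventually (hf x₀ c hc)] with r hr
      rw [EReal.coe_mul]
      exact mul_le_mul_of_nonneg_left hr.le (EReal.coe_nonneg.2 (ha r))
    have h2 : Tendsto (fun r => ((a r * c : ℝ) : EReal)) atTop (𝓝 ((a₀ * c : ℝ) : EReal)) :=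
      (continuous_coe_real_ereal.tendsto _).comp (hlim.mul_const c)
    exact (limsup_le_limsup h1).trans h2.limsup_eq.le
  have ha₀ : 0 ≤ a₀ := ge_of_tendsto' hlim ha
  rcases ha₀.eq_or_lt with h0 | h0
  · obtain ⟨c, hc, -⟩ := EReal.lt_iff_exists_real_btwn.1 (htop x₀)
    have := key c hc
    rw [← h0] at this ⊢
    simpa using this
  · rcases eq_bot_or_bot_lt (f x₀) with hb | hb
    · rw [hb, EReal.coe_mul_bot_of_pos h0]
      refine EReal.le_of_forall_lt_iff_le.1 fun z _ => ?_
      have := key (z / a₀) (by rw [hb]; exact EReal.bot_lt_coe _)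
      rwa [mul_div_cancel₀ _ h0.ne'] at this
    · lift f x₀ to ℝ using ⟨(htop x₀).ne, hb.ne'⟩ with y hy
      rw [← EReal.coe_mul]
      refine EReal.le_of_forall_lt_iff_le.1 fun z hz => ?_
      have := key (z / a₀) (by
        rw [EReal.coe_lt_coe_iff] at hz ⊢
        rwa [lt_div_iff₀ h0, mul_comm])
      rwa [mul_div_cancel₀ _ h0.ne'] at this

/-! ### Consequences of the convexity assumption -/

lemma le_loss {E : Type*} {K : ℕ} {ℓ : Fin K → E → EReal} (k : Fin K) (x : E) :
    ℓ k x ≤ loss ℓ x := le_iSup (fun k => ℓ k x) k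

lemma exists_eq_loss {E : Type*} {K : ℕ} {ℓ : Fin K → E → EReal} (hK : 0 < K) (x : E) :
    ∃ k, ℓ k x = loss ℓ x :=
  haveI : Nonempty (Fin K) := ⟨⟨0, hK⟩⟩
  exists_eq_ciSup_of_finite

section Assumption

variable {E : Type*} [NormedAddCommGroup E] [NormedSpace ℝ E] {Ξ : Set E} {K : ℕ}
  {ℓ : Fin K → E → EReal}

lemma ConvexityAssumption.lt_top (h : ConvexityAssumption Ξ ℓ) (k : Fin K) (x : E) :
    ℓ k x < ⊤ := by
  have := (h.proper k).2 x
  rwa [← EReal.neg_top, EReal.neg_lt_neg_iff] at this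

lemma ConvexityAssumption.usc (h : ConvexityAssumption Ξ ℓ) (k : Fin K) :
    UpperSemicontinuous (ℓ k) := by
  intro x y hy
  filter_upwards [h.lsc k x (-y) (EReal.neg_lt_neg_iff.2 hy)] with z hz
  exact EReal.neg_lt_neg_iff.1 hz

lemma ConvexityAssumption.isClosed_epigraph (h : ConvexityAssumption Ξ ℓ) (k : Fin K) :
    IsClosed {p : E × ℝ | -ℓ k p.1 ≤ (p.2 : EReal)} :=
  (h.lsc k).isClosed_epigraph.preimage
    (continuous_fst.prodMk (continuous_coe_real_ereal.comp continuous_snd))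

lemma ConvexityAssumption.measurable [MeasurableSpace E] [BorelSpace E]
    (h : ConvexityAssumption Ξ ℓ) (k : Fin K) : Measurable (ℓ k) :=
  (h.usc k).measurable

lemma ConvexityAssumption.measurable_loss [MeasurableSpace E] [BorelSpace E]
    (h : ConvexityAssumption Ξ ℓ) : Measurable (loss ℓ) :=
  Measurable.iSup h.measurable

lemma ConvexityAssumption.loss_lt_top (h : ConvexityAssumption Ξ ℓ) (hK : 0 < K) (x : E) :
    loss ℓ x < ⊤ := by
  obtain ⟨k, hk⟩ := exists_eq_loss (ℓ := ℓ) hK x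
  exact hk ▸ h.lt_top k x

/-- The weighted sum `∑ i, ∑ k, α i k * ℓ k (ξ i k)`. -/
def weightedLoss {N : ℕ} (ℓ : Fin K → E → EReal) (α : Fin N → Fin K → ℝ)
    (ξ : Fin N → Fin K → E) : EReal :=
  ∑ i, ∑ k, ((α i k : ℝ) : EReal) * ℓ k (ξ i k)

lemma objective_eq {N : ℕ} (data : Fin N → E) (α : Fin N → Fin K → ℝ) (q : Fin N → Fin K → E) :
    objective data ℓ α q =
      ((1 / (N : ℝ) : ℝ) : EReal) * weightedLoss ℓ α (atoms data α q) := rfl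

lemma ConvexityAssumption.limsup_weightedLoss_le (h : ConvexityAssumption Ξ ℓ) {N : ℕ}
    {α : ℕ → Fin N → Fin K → ℝ} {ξ : ℕ → Fin N → Fin K → E} {αs : Fin N → Fin K → ℝ}
    {ξs : Fin N → Fin K → E} (hα : ∀ r i k, 0 ≤ α r i k) (hαs : Tendsto α atTop (𝓝 αs))
    (hξs : Tendsto ξ atTop (𝓝 ξs)) :
    limsup (fun r => weightedLoss ℓ (α r) (ξ r)) atTop ≤ weightedLoss ℓ αs ξs := by
  have lα : ∀ i k, Tendsto (fun r => α r i k) atTop (𝓝 (αs i k)) := fun i k =>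
    (tendsto_pi_nhds.1 ((tendsto_pi_nhds.1 hαs) i)) k
  have lξ : ∀ i k, Tendsto (fun r => ξ r i k) atTop (𝓝 (ξs i k)) := fun i k =>
    (tendsto_pi_nhds.1 ((tendsto_pi_nhds.1 hξs) i)) k
  have t : ∀ i k, ((αs i k : ℝ) : EReal) * ℓ k (ξs i k) < ⊤ := fun i k =>
    coe_mul_lt_top (ge_of_tendsto' (lα i k) fun r => hα r i k) (h.lt_top k _)
  exact limsup_sum_le _ (fun i _ => ereal_sum_lt_top _ fun k _ => t i k) fun i _ =>
    limsup_sum_le _ (fun k _ => t i k) fun k _ =>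
      limsup_coe_mul_le (h.usc k) (h.lt_top k) (fun r => hα r i k) (lα i k) (lξ i k)

/-- The minorant `v` is kept general to serve twice: constant in the right-continuity argument, and
equal to the objective along a maximizing sequence. -/
lemma ConvexityAssumption.le_of_tendsto_weightedLoss (h : ConvexityAssumption Ξ ℓ) {N : ℕ}
    {α : ℕ → Fin N → Fin K → ℝ} {ξ : ℕ → Fin N → Fin K → E} {αs : Fin N → Fin K → ℝ}
    {ξs : Fin N → Fin K → E} (hα : ∀ r i k, 0 ≤ α r i k) (hαs : Tendsto α atTop (𝓝 αs))
    (hξs : Tendsto ξ atTop (𝓝 ξs)) {v : ℕ → EReal} {w : EReal} {c : ℝ} (hc : 0 ≤ c)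
    (hv : ∀ r, v r ≤ (c : EReal) * weightedLoss ℓ (α r) (ξ r)) (hw : Tendsto v atTop (𝓝 w)) :
    w ≤ (c : EReal) * weightedLoss ℓ αs ξs := by
  have hl := h.limsup_weightedLoss_le hα hαs hξs
  have h1 : limsup (fun r => (c : EReal) * weightedLoss ℓ (α r) (ξ r)) atTop ≤
      (c : EReal) * weightedLoss ℓ αs ξs := by
    have hmono : Monotone fun x : EReal => (c : EReal) * x := fun x y hxy =>
      mul_le_mul_of_nonneg_left hxy (EReal.coe_nonneg.2 hc)
    rcases hc.eq_or_lt with rfl | hc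
    · simp
    have hcont : Continuous fun x : EReal => (c : EReal) * x := by
      have hc' : (c : EReal) ≠ 0 := by exact_mod_cast hc.ne'
      refine continuous_iff_continuousAt.2 fun x => ?_
      have := EReal.continuousAt_mul (p := ((c : EReal), x)) (Or.inl hc')
        (Or.inl hc') (Or.inl (EReal.coe_ne_bot c))
        (Or.inl (EReal.coe_ne_top c))
      exact this.comp (Continuous.prodMk_right (c : EReal)).continuousAt
    have := hmono.map_limsup_of_continuousAt (F := atTop)
      (fun r => weightedLoss ℓ (α r) (ξ r)) hcont.continuousAt
    exact (this.symm.le).trans (hmono hl)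
  exact (hw.limsup_eq.symm.le.trans (limsup_le_limsup (Eventually.of_forall hv))).trans h1

end Assumption

/-! ### Decisions described by their atoms -/

section Atoms

variable {E : Type*} [NormedAddCommGroup E] {Ξ : Set E} {N K : ℕ}
  {data : Fin N → E} {ε : ℝ} {α : Fin N → Fin K → ℝ} {ξ q : Fin N → Fin K → E}
  {ℓ : Fin K → E → EReal}

/-- Feasibility of weights `α i k` and atoms `ξ i k`, without the variables `q i k`. -/
structure AtomFeasible (Ξ : Set E) (data : Fin N → E) (ε : ℝ)
    (α : Fin N → Fin K → ℝ) (ξ : Fin N → Fin K → E) : Prop where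
  budget : (1 / (N : ℝ)) * ∑ i, ∑ k, α i k * ‖data i - ξ i k‖ ≤ ε
  sum_one : ∀ i, ∑ k, α i k = 1
  nonneg : ∀ i k, 0 ≤ α i k
  mem : ∀ i k, ξ i k ∈ Ξ

lemma AtomFeasible.le_one (h : AtomFeasible Ξ data ε α ξ) (i : Fin N) (k : Fin K) :
    α i k ≤ 1 := by
  rw [← h.sum_one i]
  exact Finset.single_le_sum (fun k _ => h.nonneg i k) (Finset.mem_univ k)

lemma AtomFeasible.mul_norm_le (h : AtomFeasible Ξ data ε α ξ) (hN : 0 < N) (i : Fin N)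
    (k : Fin K) : α i k * ‖data i - ξ i k‖ ≤ N * ε := by
  have hN' : (0 : ℝ) < N := Nat.cast_pos.2 hN
  have hn : ∀ i k, 0 ≤ α i k * ‖data i - ξ i k‖ := fun i k =>
    mul_nonneg (h.nonneg i k) (norm_nonneg _)
  have h1 : α i k * ‖data i - ξ i k‖ ≤ ∑ k, α i k * ‖data i - ξ i k‖ :=
    Finset.single_le_sum (f := fun k => α i k * ‖data i - ξ i k‖) (fun k _ => hn i k)
      (Finset.mem_univ k)
  have h2 : ∑ k, α i k * ‖data i - ξ i k‖ ≤ ∑ i, ∑ k, α i k * ‖data i - ξ i k‖ :=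
    Finset.single_le_sum (f := fun i => ∑ k, α i k * ‖data i - ξ i k‖)
      (fun i _ => Finset.sum_nonneg fun k _ => hn i k) (Finset.mem_univ i)
  have h3 := h.budget
  rw [one_div, inv_mul_le_iff₀ hN'] at h3
  linarith

/-- If `Ξ` is compact or there is a single loss function, then the atoms of decisions of bounded
budget are uniformly bounded. -/
lemma exists_norm_atoms_le (hN : 0 < N) (data : Fin N → E) (hcase : IsCompact Ξ ∨ K = 1) (c : ℝ) :
    ∃ R, ∀ ε ≤ c, ∀ (α : Fin N → Fin K → ℝ) (ξ : Fin N → Fin K → E),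
      AtomFeasible Ξ data ε α ξ → ∀ i k, ‖ξ i k‖ ≤ R := by
  rcases hcase with hc | rfl
  · obtain ⟨R, hR⟩ := hc.isBounded.exists_norm_le
    exact ⟨R, fun ε _ α ξ h i k => hR _ (h.mem i k)⟩
  -- With one loss function every weight is `1`, so the budget alone bounds the distance of each
  -- atom from its data point by `N * c`.
  · refine ⟨∑ i, ‖data i‖ + N * c, fun ε hε α ξ h i k => ?_⟩
    have h1 : α i k = 1 := by
      have := h.sum_one i
      rwa [Fin.sum_univ_one, ← Subsingleton.elim k 0] at this
    have h2 := h.mul_norm_le hN i k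
    rw [h1, one_mul] at h2
    have h3 : ‖data i‖ ≤ ∑ i, ‖data i‖ :=
      Finset.single_le_sum (f := fun i => ‖data i‖) (fun i _ => norm_nonneg _) (Finset.mem_univ i)
    have h4 : ‖ξ i k‖ ≤ ‖data i‖ + ‖data i - ξ i k‖ := by
      simpa using norm_sub_le (data i) (data i - ξ i k)
    have h5 : (N : ℝ) * ε ≤ N * c := by gcongr
    linarith

/-- All constraints are closed conditions in `(α, ξ)`, including where weights vanish in the limit.
The budgets may vary, so that they can shrink to `ε`. -/
lemma AtomFeasible.of_tendsto (hΞ : IsClosed Ξ) {e : ℕ → ℝ} (he : Tendsto e atTop (𝓝 ε))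
    {a : ℕ → Fin N → Fin K → ℝ} {x : ℕ → Fin N → Fin K → E}
    (h : ∀ r, AtomFeasible Ξ data (e r) (a r) (x r)) (ha : Tendsto a atTop (𝓝 α))
    (hx : Tendsto x atTop (𝓝 ξ)) : AtomFeasible Ξ data ε α ξ := by
  have lα : ∀ i k, Tendsto (fun r => a r i k) atTop (𝓝 (α i k)) := fun i k =>
    (tendsto_pi_nhds.1 ((tendsto_pi_nhds.1 ha) i)) k
  have lξ : ∀ i k, Tendsto (fun r => x r i k) atTop (𝓝 (ξ i k)) := fun i k =>
    (tendsto_pi_nhds.1 ((tendsto_pi_nhds.1 hx) i)) k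
  refine ⟨?_, fun i => ?_, fun i k => ge_of_tendsto' (lα i k) fun r => (h r).nonneg i k,
    fun i k => hΞ.mem_of_tendsto (lξ i k) (Eventually.of_forall fun r => (h r).mem i k)⟩
  · refine le_of_tendsto_of_tendsto' ?_ he fun r => (h r).budget
    exact (tendsto_finsetSum _ fun i _ => tendsto_finsetSum _ fun k _ =>
      (lα i k).mul ((lξ i k).const_sub _).norm).const_mul _
  · refine tendsto_nhds_unique (tendsto_finsetSum _ fun k _ => lα i k) ?_
    simp only [(h _).sum_one i]
    exact tendsto_const_nhds

variable [NormedSpace ℝ E]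

lemma Feasible.mul_norm_sub_atoms (h : Feasible Ξ data ε α q) (i : Fin N) (k : Fin K) :
    α i k * ‖data i - atoms data α q i k‖ = ‖q i k‖ := by
  rw [atoms, sub_sub_cancel, norm_smul, norm_inv, Real.norm_of_nonneg (h.nonneg i k)]
  by_cases h0 : α i k = 0
  -- The field `zero` is indispensable here: a nonzero `q` with zero weight would spend budget that
  -- the atoms cannot see.
  · simp [h0, h.zero i k h0]
  · rw [mul_inv_cancel_left₀ h0]

lemma Feasible.atomFeasible (h : Feasible Ξ data ε α q) :
    AtomFeasible Ξ data ε α (atoms data α q) where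
  budget := by simpa only [h.mul_norm_sub_atoms] using h.budget
  sum_one := h.sum_one
  nonneg := h.nonneg
  mem := h.mem

lemma AtomFeasible.atoms_eq (i : Fin N) (k : Fin K) (h : α i k ≠ 0) :
    atoms data α (fun i k => α i k • (data i - ξ i k)) i k = ξ i k := by
  simp [atoms, inv_smul_smul₀ h]

lemma AtomFeasible.feasible (h : AtomFeasible Ξ data ε α ξ) (hdata : ∀ i, data i ∈ Ξ) :
    Feasible Ξ data ε α (fun i k => α i k • (data i - ξ i k)) where
  budget := by
    simpa only [norm_smul, Real.norm_of_nonneg (h.nonneg _ _)] using h.budget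
  sum_one := h.sum_one
  nonneg := h.nonneg
  zero := fun i k h0 => by simp [h0]
  mem := fun i k => by
    by_cases h0 : α i k = 0
    · simpa [atoms, h0] using hdata i
    · rw [AtomFeasible.atoms_eq i k h0]; exact h.mem i k

/-- Passing to `q` moves every atom of zero weight to `data i`; the value is unchanged because its
term is `0` either way. -/
lemma AtomFeasible.le_optimalValue (h : AtomFeasible Ξ data ε α ξ) (hdata : ∀ i, data i ∈ Ξ) :
    ((1 / (N : ℝ) : ℝ) : EReal) * weightedLoss ℓ α ξ ≤ optimalValue Ξ data ε ℓ := by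
  refine le_sSup ⟨α, _, h.feasible hdata, ?_⟩
  rw [objective_eq]
  congr 1
  refine Finset.sum_congr rfl fun i _ => Finset.sum_congr rfl fun k _ => ?_
  by_cases h0 : α i k = 0
  · simp [h0]
  · rw [AtomFeasible.atoms_eq i k h0]

lemma exists_mapClusterPt_of_atomFeasible [FiniteDimensional ℝ E] (hN : 0 < N)
    (hcase : IsCompact Ξ ∨ K = 1) (c : ℝ) {ε : ℕ → ℝ} (hε : ∀ r, ε r ≤ c)
    {α : ℕ → Fin N → Fin K → ℝ} {ξ : ℕ → Fin N → Fin K → E}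
    (h : ∀ r, AtomFeasible Ξ data (ε r) (α r) (ξ r)) :
    ∃ p : (Fin N → Fin K → ℝ) × (Fin N → Fin K → E),
      MapClusterPt p atTop fun r => (α r, ξ r) := by
  have : ProperSpace E := FiniteDimensional.proper ℝ E
  obtain ⟨R, hR⟩ := exists_norm_atoms_le (Ξ := Ξ) hN data hcase c
  have hcomp : IsCompact
      ((Set.univ.pi fun _ : Fin N => Set.univ.pi fun _ : Fin K => Set.Icc (0 : ℝ) 1) ×ˢ
        (Set.univ.pi fun _ : Fin N => Set.univ.pi fun _ : Fin K =>
          Metric.closedBall (0 : E) R)) :=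
    (isCompact_univ_pi fun _ => isCompact_univ_pi fun _ => isCompact_Icc).prod
      (isCompact_univ_pi fun _ => isCompact_univ_pi fun _ => isCompact_closedBall _ _)
  obtain ⟨p, -, hp⟩ := hcomp.exists_mapClusterPt (f := atTop) (u := fun r => (α r, ξ r))
    (le_principal_iff.2 (mem_map.2 (Eventually.of_forall fun r =>
      ⟨fun i _ k _ => ⟨(h r).nonneg i k, (h r).le_one i k⟩,
        fun i _ k _ => mem_closedBall_zero_iff.2 (hR _ (hε r) _ _ (h r) i k)⟩)))
  exact ⟨p, hp⟩

lemma exists_feasible (hK : 0 < K) (hdata : ∀ i, data i ∈ Ξ) (hε : 0 ≤ ε) :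
    ∃ (α : Fin N → Fin K → ℝ) (q : Fin N → Fin K → E), Feasible Ξ data ε α q := by
  refine ⟨fun _ => Pi.single ⟨0, hK⟩ 1, fun _ _ => 0, by simpa using hε, fun i => by simp,
    fun i k => ?_, by simp, fun i k => by simpa [atoms] using hdata i⟩
  exact (Pi.single_nonneg (α := fun _ => ℝ)).2 zero_le_one k

lemma exists_isMaximizing (hK : 0 < K) (hdata : ∀ i, data i ∈ Ξ) (hε : 0 ≤ ε)
    (ℓ : Fin K → E → EReal) : ∃ α q, IsMaximizing Ξ data ε ℓ α q := by
  obtain ⟨α₀, q₀, h₀⟩ := exists_feasible (N := N) (data := data) hK hdata hε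
  obtain ⟨u, -, hu, hmem⟩ := exists_seq_tendsto_sSup
    (S := {v | ∃ α q, Feasible Ξ data ε α q ∧ objective data ℓ α q = v})
    ⟨_, α₀, q₀, h₀, rfl⟩ (OrderTop.bddAbove _)
  choose α q hf hv using hmem
  exact ⟨α, q, hf, by simpa only [hv, optimalValue] using! hu⟩

/-- The optimal value is right-continuous in the budget. -/
lemma le_optimalValue_of_forall [FiniteDimensional ℝ E] (hN : 0 < N)
    (hdata : ∀ i, data i ∈ Ξ) (hℓ : ConvexityAssumption Ξ ℓ)
    (hcase : IsCompact Ξ ∨ K = 1) {v : EReal}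
    (hv : ∀ δ > 0, v ≤ optimalValue Ξ data (ε + δ) ℓ) : v ≤ optimalValue Ξ data ε ℓ := by
  refine le_of_forall_lt_imp_le_of_dense fun w hw => ?_
  have hpos : ∀ r : ℕ, (0 : ℝ) < 1 / ((r : ℝ) + 1) := fun r => Nat.one_div_pos_of_nat
  -- A value `w` strictly below the bound is reached by an actual decision at each enlarged budget;
  -- a limit of these decisions has budget `ε` and value at least `w`.
  have hex : ∀ r : ℕ, ∃ (α : Fin N → Fin K → ℝ) (q : Fin N → Fin K → E),
      Feasible Ξ data (ε + 1 / ((r : ℝ) + 1)) α q ∧ w ≤ objective data ℓ α q := by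
    intro r
    obtain ⟨_, ⟨α, q, hf, rfl⟩, h⟩ := lt_sSup_iff.1 (hw.trans_le (hv _ (hpos r)))
    exact ⟨α, q, hf, h.le⟩
  choose α q hf hwo using hex
  have hle : ∀ r : ℕ, ε + 1 / ((r : ℝ) + 1) ≤ ε + 1 := fun r => by
    have : 1 / ((r : ℝ) + 1) ≤ 1 := by
      rw [div_le_one (by positivity)]; linarith [(Nat.cast_nonneg r : (0 : ℝ) ≤ r)]
    linarith
  obtain ⟨⟨αs, ξs⟩, hp⟩ := exists_mapClusterPt_of_atomFeasible hN hcase (ε + 1) hle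
    fun r => (hf r).atomFeasible
  obtain ⟨ψ, hψ, hlim⟩ := hp.tendsto_subseq
  have ha := (continuous_fst.tendsto _).comp hlim
  have hx := (continuous_snd.tendsto _).comp hlim
  have he : Tendsto (fun r => ε + 1 / ((ψ r : ℝ) + 1)) atTop (𝓝 ε) := by
    simpa using (tendsto_one_div_add_atTop_nhds_zero_nat.comp hψ.tendsto_atTop).const_add ε
  have hfeas := AtomFeasible.of_tendsto hℓ.closed_set he (fun r => (hf (ψ r)).atomFeasible) ha hx
  exact (hℓ.le_of_tendsto_weightedLoss (fun r => (hf (ψ r)).nonneg) ha hx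
    (one_div_nonneg.2 (Nat.cast_nonneg N)) (fun r => hwo (ψ r)) tendsto_const_nhds).trans
    (hfeas.le_optimalValue hdata)

end Atoms

/-! ### Expectations -/

section Expectation

variable {E : Type*} [MeasurableSpace E]

/-- The expectation of a function that is never `+∞` and has integrable positive and negative
parts is a Bochner integral. -/
lemma expectation_eq_integral {Q : Measure E} {f : E → EReal} (hf : Measurable f)
    (htop : ∀ x, f x < ⊤) (hpos : ∫⁻ x, (f x).toENNReal ∂Q ≠ ⊤)
    (hneg : ∫⁻ x, (-f x).toENNReal ∂Q ≠ ⊤) :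
    (∀ᵐ x ∂Q, ((f x).toReal : EReal) = f x) ∧ Integrable (fun x => (f x).toReal) Q ∧
      expectation Q f = ((∫ x, (f x).toReal ∂Q : ℝ) : EReal) := by
  have hae : ∀ᵐ x ∂Q, ((f x).toReal : EReal) = f x := by
    -- A finite negative part rules out the value `⊥` almost everywhere.
    filter_upwards [ae_lt_top hf.neg.ereal_toENNReal hneg] with x hx
    refine EReal.coe_toReal (htop x).ne fun hb => ?_
    simp [hb] at hx
  have h1 : ∫⁻ x, ENNReal.ofReal (f x).toReal ∂Q = ∫⁻ x, (f x).toENNReal ∂Q :=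
    lintegral_congr fun x => (EReal.toENNReal_of_ne_top (htop x).ne).symm
  have h2 : ∫⁻ x, ENNReal.ofReal (-(f x).toReal) ∂Q = ∫⁻ x, (-f x).toENNReal ∂Q := by
    refine lintegral_congr_ae ?_
    filter_upwards [hae] with x hx
    rw [← hx, ← EReal.coe_neg, EReal.real_coe_toENNReal, EReal.toReal_coe]
  have hint : Integrable (fun x => (f x).toReal) Q := by
    refine ⟨hf.ereal_toReal.aestronglyMeasurable, ?_⟩
    rw [hasFiniteIntegral_iff_norm]
    have : ∀ x, ENNReal.ofReal ‖(f x).toReal‖ ≤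
        ENNReal.ofReal (f x).toReal + ENNReal.ofReal (-(f x).toReal) := fun x => by
      rcases le_total 0 (f x).toReal with h | h
      · rw [Real.norm_of_nonneg h]; exact le_self_add
      · rw [Real.norm_of_nonpos h]; exact le_add_self
    refine (lintegral_mono this).trans_lt ?_
    rw [lintegral_add_left hf.ereal_toReal.ennreal_ofReal, h1, h2]
    exact ENNReal.add_lt_top.2 ⟨hpos.lt_top, hneg.lt_top⟩
  refine ⟨hae, hint, ?_⟩
  rw [expectation, if_neg hpos, integral_eq_lintegral_pos_part_sub_lintegral_neg_part hint, h1, h2,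
    EReal.coe_sub, EReal.coe_ennreal_toReal hpos, EReal.coe_ennreal_toReal hneg]

lemma lintegral_discreteDistribution {N K : ℕ} {α : Fin N → Fin K → ℝ} {ξ : Fin N → Fin K → E}
    [MeasurableSingletonClass E] (f : E → ℝ≥0∞) :
    ∫⁻ x, f x ∂(discreteDistribution α ξ) =
      (N : ℝ≥0∞)⁻¹ * ∑ i, ∑ k, ENNReal.ofReal (α i k) * f (ξ i k) := by
  simp [discreteDistribution, lintegral_finsetSum_measure]

end Expectation

/-! ### Discrete distributions -/

section Discrete

variable {E : Type*} [NormedAddCommGroup E] {Ξ : Set E} {N K : ℕ}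
  {data : Fin N → E} {ε : ℝ} {α : Fin N → Fin K → ℝ} {ξ : Fin N → Fin K → E}
  {ℓ : Fin K → E → EReal}

lemma sum_ofReal_eq_one (h : AtomFeasible Ξ data ε α ξ) (i : Fin N) :
    ∑ k, ENNReal.ofReal (α i k) = 1 := by
  rw [← ENNReal.ofReal_sum_of_nonneg fun k _ => h.nonneg i k, h.sum_one i, ENNReal.ofReal_one]

lemma inv_mul_sum_one (hN : 0 < N) : (N : ℝ≥0∞)⁻¹ * ∑ _i : Fin N, (1 : ℝ≥0∞) = 1 := by
  rw [Finset.sum_const, Finset.card_univ, Fintype.card_fin, nsmul_eq_mul, mul_one]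
  exact ENNReal.inv_mul_cancel (by exact_mod_cast hN.ne') (ENNReal.natCast_ne_top N)

variable [MeasurableSpace E] [BorelSpace E]

lemma AtomFeasible.mem_ball [SecondCountableTopology E]
    (h : AtomFeasible Ξ data ε α ξ) (hN : 0 < N) (hΞ : IsClosed Ξ) :
    discreteDistribution α ξ ∈ ball Ξ data ε := by
  have hNi : (N : ℝ≥0∞)⁻¹ ≠ ⊤ := ENNReal.inv_ne_top.2 (by exact_mod_cast hN.ne')
  refine ⟨⟨⟨?_⟩, ?_, ?_⟩, ?_⟩
  · rw [← lintegral_one, lintegral_discreteDistribution]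
    simp only [mul_one, sum_ofReal_eq_one h]
    exact inv_mul_sum_one hN
  · rw [← lintegral_indicator_one hΞ.measurableSet.compl, lintegral_discreteDistribution]
    simp [h.mem]
  · rw [lintegral_discreteDistribution]
    refine ENNReal.mul_lt_top hNi.lt_top (ENNReal.sum_lt_top.2 fun i _ =>
      ENNReal.sum_lt_top.2 fun k _ => ENNReal.mul_lt_top ENNReal.ofReal_lt_top enorm_lt_top)
  -- This coupling moves mass `α i k / N` from `data i` to `ξ i k`; its cost is the left side of the
  -- budget constraint.
  · let P : Measure (E × E) := (N : ℝ≥0∞)⁻¹ • ∑ i, ∑ k,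
      ENNReal.ofReal (α i k) • Measure.dirac (data i, ξ i k)
    have hP : P ∈ couplings (empirical data) (discreteDistribution α ξ) := by
      constructor
      · simp only [P, Measure.map_smul, Measure.map_finset_sum measurable_fst.aemeasurable,
          Measure.map_dirac' measurable_fst, ← Finset.sum_smul, sum_ofReal_eq_one h, one_smul,
          empirical]
      · simp only [P, Measure.map_smul, Measure.map_finset_sum measurable_snd.aemeasurable,
          Measure.map_dirac' measurable_snd, discreteDistribution]
    refine (iInf₂_le P hP).trans ?_
    have h1 : ∫⁻ z, ‖z.1 - z.2‖ₑ ∂P =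
        (N : ℝ≥0∞)⁻¹ * ∑ i, ∑ k, ENNReal.ofReal (α i k) * ‖data i - ξ i k‖ₑ := by
      simp [P, lintegral_finsetSum_measure]
    have h2 : ∀ i k, ENNReal.ofReal (α i k) * ‖data i - ξ i k‖ₑ =
        ENNReal.ofReal (α i k * ‖data i - ξ i k‖) := fun i k => by
      rw [ENNReal.ofReal_mul (h.nonneg i k), ofReal_norm]
    have h3 : ∀ i k, 0 ≤ α i k * ‖data i - ξ i k‖ := fun i k =>
      mul_nonneg (h.nonneg i k) (norm_nonneg _)
    simp only [h1, h2]
    simp only [← ENNReal.ofReal_sum_of_nonneg fun k (_ : k ∈ Finset.univ) => h3 _ k]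
    rw [← ENNReal.ofReal_sum_of_nonneg fun i _ => Finset.sum_nonneg fun k _ => h3 i k,
      ← ENNReal.ofReal_natCast, ← ENNReal.ofReal_inv_of_pos (Nat.cast_pos.2 hN),
      ← ENNReal.ofReal_mul (by positivity)]
    exact ENNReal.ofReal_le_ofReal (by simpa using h.budget)

/-- Only an inequality, since `ℓ k` need not be the maximal loss at `ξ i k`. If no atom of positive
weight has `ℓ k = ⊥`, the loss is finite at all those atoms and the expectation is a finite sum. -/
lemma AtomFeasible.le_expectation [NormedSpace ℝ E] (h : AtomFeasible Ξ data ε α ξ) (hN : 0 < N) (hK : 0 < K)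
    (hℓ : ConvexityAssumption Ξ ℓ) :
    ((1 / (N : ℝ) : ℝ) : EReal) * weightedLoss ℓ α ξ ≤
      expectation (discreteDistribution α ξ) (loss ℓ) := by
  have hN' : (0 : ℝ) < 1 / N := one_div_pos.2 (Nat.cast_pos.2 hN)
  have hNi : (N : ℝ≥0∞)⁻¹ ≠ ⊤ := ENNReal.inv_ne_top.2 (by exact_mod_cast hN.ne')
  by_cases hbot : ∃ i k, α i k ≠ 0 ∧ ℓ k (ξ i k) = ⊥
  · obtain ⟨i, k, h0, hb⟩ := hbot
    have : weightedLoss ℓ α ξ = ⊥ := by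
      refine ereal_sum_eq_bot _ (Finset.mem_univ i) (ereal_sum_eq_bot _ (Finset.mem_univ k) ?_)
      rw [hb, EReal.coe_mul_bot_of_pos ((h.nonneg i k).lt_of_ne' h0)]
    rw [this, EReal.coe_mul_bot_of_pos hN']
    exact bot_le
  · push Not at hbot
    have hloss : ∀ i k, α i k ≠ 0 → loss ℓ (ξ i k) ≠ ⊥ := fun i k h0 hb =>
      hbot i k h0 (le_bot_iff.1 (hb ▸ le_loss k _))
    have fin : ∀ g : EReal → EReal, (∀ i k, α i k ≠ 0 → g (loss ℓ (ξ i k)) ≠ ⊤) →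
        ∫⁻ x, (g (loss ℓ x)).toENNReal ∂(discreteDistribution α ξ) ≠ ⊤ := by
      intro g hg
      rw [lintegral_discreteDistribution]
      refine (ENNReal.mul_lt_top hNi.lt_top (ENNReal.sum_lt_top.2 fun i _ =>
        ENNReal.sum_lt_top.2 fun k _ => ?_)).ne
      by_cases h0 : α i k = 0
      · simp [h0]
      · exact ENNReal.mul_lt_top ENNReal.ofReal_lt_top
          (EReal.toENNReal_ne_top_iff.2 (hg i k h0)).lt_top
    obtain ⟨-, -, heq⟩ := expectation_eq_integral (Q := discreteDistribution α ξ)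
      hℓ.measurable_loss (hℓ.loss_lt_top hK) (fin id fun i k _ => (hℓ.loss_lt_top hK _).ne)
      (fin (fun y => -y) fun i k h0 => by simpa using hloss i k h0)
    have hi : ∀ i k, Integrable (fun x => (loss ℓ x).toReal)
        (ENNReal.ofReal (α i k) • Measure.dirac (ξ i k)) := fun i k =>
      (integrable_dirac (by simp)).smul_measure ENNReal.ofReal_ne_top
    have hint : ∫ x, (loss ℓ x).toReal ∂(discreteDistribution α ξ) =
        (1 / (N : ℝ)) * ∑ i, ∑ k, α i k * (loss ℓ (ξ i k)).toReal := by
      rw [discreteDistribution, integral_smul_measure, integral_finsetSum_measure fun i _ =>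
        integrable_finsetSum_measure.2 fun k _ => hi i k]
      simp only [integral_finsetSum_measure fun k (_ : k ∈ Finset.univ) => hi _ k,
        integral_smul_measure, integral_dirac, ENNReal.toReal_ofReal (h.nonneg _ _), smul_eq_mul]
      simp
    rw [heq, hint, EReal.coe_mul]
    refine mul_le_mul_of_nonneg_left ?_ (EReal.coe_nonneg.2 hN'.le)
    simp only [ereal_coe_sum]
    refine Finset.sum_le_sum fun i _ => Finset.sum_le_sum fun k _ => ?_
    by_cases h0 : α i k = 0
    · simp [h0]
    · rw [EReal.coe_mul, EReal.coe_toReal (hℓ.loss_lt_top hK _).ne (hloss i k h0)]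
      exact mul_le_mul_of_nonneg_left (le_loss k _) (EReal.coe_nonneg.2 (h.nonneg i k))

end Discrete

/-! ### Jensen's inequality -/

section Jensen

variable {E : Type*} [NormedAddCommGroup E] [NormedSpace ℝ E] [FiniteDimensional ℝ E]
  [MeasurableSpace E] {f : E → EReal} {μ : Measure E}

/-- Jensen's inequality for upper semicontinuous concave extended-real-valued functions. -/
lemma average_le_of_isConvexFun_neg [IsFiniteMeasure μ] [NeZero μ]
    (hconv : IsConvexFun fun x => -f x)
    (hclosed : IsClosed {p : E × ℝ | -f p.1 ≤ (p.2 : EReal)})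
    (hid : Integrable (fun x : E => x) μ) {g : E → ℝ} (hg : Integrable g μ)
    (hle : ∀ᵐ x ∂μ, (g x : EReal) ≤ f x) :
    ((⨍ x, g x ∂μ : ℝ) : EReal) ≤ f (⨍ x, x ∂μ) := by
  have : CompleteSpace E := FiniteDimensional.complete ℝ E
  -- The points `(x, -g x)` lie in the closed convex epigraph of `-f`, hence so does their average.
  -- A real minorant `g` avoids integrating extended values.
  have h := hconv.average_mem (f := fun x => (x, -g x)) hclosed
    (by
      filter_upwards [hle] with x hx
      rw [EReal.coe_neg]
      exact EReal.neg_le_neg_iff.2 hx) (hid.prodMk hg.neg)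
  rw [average_pair (g := fun x => -g x) hid hg.neg, average_neg] at h
  have h' : -f (⨍ x, x ∂μ) ≤ ((-⨍ x, g x ∂μ : ℝ) : EReal) := h
  rwa [EReal.coe_neg, EReal.neg_le_neg_iff] at h'

/-- On `{0 < f}`, Jensen bounds the averages of the truncations `min f n` by the value of `f` at the
barycenter, uniformly in `n`; monotone convergence concludes. Thus a finite first moment excludes
expectation `⊤`. -/
lemma lintegral_toENNReal_ne_top [IsFiniteMeasure μ] (hconv : IsConvexFun fun x => -f x)
    (hclosed : IsClosed {p : E × ℝ | -f p.1 ≤ (p.2 : EReal)}) (hf : Measurable f)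
    (htop : ∀ x, f x < ⊤) (hid : Integrable (fun x : E => x) μ) :
    ∫⁻ x, (f x).toENNReal ∂μ ≠ ⊤ := by
  have hB : MeasurableSet {x | 0 < f x} := measurableSet_lt measurable_const hf
  have hsplit : ∫⁻ x, (f x).toENNReal ∂μ = ∫⁻ x in {x | 0 < f x}, (f x).toENNReal ∂μ := by
    rw [← lintegral_indicator hB]
    refine lintegral_congr fun x => ?_
    by_cases hx : 0 < f x
    · rw [Set.indicator_of_mem (by exact hx)]
    · rw [Set.indicator_of_notMem (by exact hx), EReal.toENNReal_of_nonpos (not_lt.1 hx)]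
  rw [hsplit]
  rcases eq_or_ne (μ.restrict {x | 0 < f x}) 0 with h0 | h0
  · simp [h0]
  set ν := μ.restrict {x | 0 < f x}
  have : NeZero ν := ⟨h0⟩
  have hpos : ∀ᵐ x ∂ν, 0 < f x := ae_restrict_mem hB
  let g : ℕ → E → ℝ := fun n x => min (f x).toReal n
  have hg0 : ∀ n, ∀ᵐ x ∂ν, 0 ≤ g n x := fun n => by
    filter_upwards [hpos] with x hx
    exact le_min (EReal.toReal_nonneg hx.le) (Nat.cast_nonneg n)
  have hgm : ∀ n, Measurable (g n) := fun n => hf.ereal_toReal.min measurable_const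
  have hgi : ∀ n, Integrable (g n) ν := fun n =>
    Integrable.of_bound (hgm n).aestronglyMeasurable (n : ℝ) (by
      filter_upwards [hg0 n] with x hx
      rw [Real.norm_of_nonneg hx]
      exact min_le_right _ _)
  have hle : ∀ n, ∀ᵐ x ∂ν, (g n x : EReal) ≤ f x := fun n => by
    filter_upwards [hpos] with x hx
    calc (g n x : EReal) ≤ ((f x).toReal : EReal) := EReal.coe_le_coe_iff.2 (min_le_left _ _)
      _ = f x := EReal.coe_toReal (htop x).ne ((EReal.bot_lt_coe 0).trans hx).ne'
  obtain ⟨c, hc, -⟩ := EReal.lt_iff_exists_real_btwn.1 (htop (⨍ x, x ∂ν))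
  have hbound : ∀ n, ∫⁻ x, ENNReal.ofReal (g n x) ∂ν ≤ ENNReal.ofReal (ν.real Set.univ * c) := by
    intro n
    have h1 : ⨍ x, g n x ∂ν ≤ c := EReal.coe_le_coe_iff.1
      ((average_le_of_isConvexFun_neg hconv hclosed hid.restrict (hgi n) (hle n)).trans hc.le)
    rw [← ofReal_integral_eq_lintegral_ofReal (hgi n) (hg0 n), ← measure_smul_average, smul_eq_mul]
    exact ENNReal.ofReal_le_ofReal (mul_le_mul_of_nonneg_left h1 measureReal_nonneg)
  have hlim : Tendsto (fun n => ∫⁻ x, ENNReal.ofReal (g n x) ∂ν) atTop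
      (𝓝 (∫⁻ x, (f x).toENNReal ∂ν)) := by
    refine lintegral_tendsto_of_tendsto_of_monotone
      (fun n => (hgm n).ennreal_ofReal.aemeasurable) ?_ ?_
    · exact Eventually.of_forall fun x n m hnm =>
        ENNReal.ofReal_le_ofReal (min_le_min_left _ (Nat.cast_le.2 hnm))
    · refine Eventually.of_forall fun x => ?_
      refine tendsto_const_nhds.congr' ?_
      obtain ⟨n, hn⟩ := exists_nat_ge (f x).toReal
      filter_upwards [eventually_ge_atTop n] with m hm
      rw [EReal.toENNReal_of_ne_top (htop x).ne]
      simp only [g]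
      rw [min_eq_left (hn.trans (Nat.cast_le.2 hm))]
  exact ((le_of_tendsto' hlim hbound).trans_lt ENNReal.ofReal_lt_top).ne

end Jensen

/-! ### Decomposition of the distributions in the Wasserstein ball -/

section Decomposition

/-- The space splits into measurable pieces on which the loss is a single `ℓ k`. -/
lemma exists_measurable_partition {E : Type*} [MeasurableSpace E] {K : ℕ} (hK : 0 < K)
    {ℓ : Fin K → E → EReal} (hℓ : ∀ k, Measurable (ℓ k)) :
    ∃ A : Fin K → Set E, (∀ k, MeasurableSet (A k)) ∧ Pairwise (Function.onFun Disjoint A) ∧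
      ⋃ k, A k = Set.univ ∧ ∀ k, ∀ x ∈ A k, ℓ k x = loss ℓ x := by
  have hloss : Measurable (loss ℓ) := Measurable.iSup hℓ
  let B : Fin K → Set E := fun k => {x | ℓ k x = loss ℓ x}
  have hB : ∀ k, MeasurableSet (B k) := fun k => measurableSet_eq_fun (hℓ k) hloss
  -- Ties go to the smallest maximizing index.
  refine ⟨disjointed B, fun k => ?_, disjoint_disjointed B, ?_,
    fun k x hx => disjointed_subset B k hx⟩
  · exact disjointedRec (fun _ _ h => h.diff (hB _)) (hB k)
  rw [iUnion_disjointed, Set.eq_univ_iff_forall]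
  exact fun x => Set.mem_iUnion.2 (exists_eq_loss hK x)

lemma integrable_of_eq_inv_smul_sum {E F : Type*} [MeasurableSpace E] [NormedAddCommGroup F]
    {N : ℕ} (hN : 0 < N) {Q : Measure E} {ν : Fin N → Measure E}
    (hQ : Q = (N : ℝ≥0∞)⁻¹ • ∑ i, ν i) {f : E → F} (hf : Integrable f Q) (i : Fin N) :
    Integrable f (ν i) := by
  rw [hQ, integrable_smul_measure (ENNReal.inv_ne_zero.2 (ENNReal.natCast_ne_top N))
    (ENNReal.inv_ne_top.2 (by exact_mod_cast hN.ne'))] at hf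
  exact integrable_finsetSum_measure.1 hf i (Finset.mem_univ i)

variable {E : Type*} [NormedAddCommGroup E] [NormedSpace ℝ E] [FiniteDimensional ℝ E]
  [MeasurableSpace E] [BorelSpace E] {Ξ : Set E} {N K : ℕ} {data : Fin N → E} {ε ε' : ℝ}

/-- A distribution in the Wasserstein ball is the mean of distributions `ν i` to which the mass at
the data points is transported at total cost arbitrarily close to the radius. -/
lemma exists_decomposition {Q : Measure E} (hQ : Q ∈ ball Ξ data ε) (hε : 0 ≤ ε)
    (hlt : ε < ε') :
    ∃ ν : Fin N → Measure E, (∀ i, IsProbabilityMeasure (ν i)) ∧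
      Q = (N : ℝ≥0∞)⁻¹ • ∑ i, ν i ∧
      (N : ℝ≥0∞)⁻¹ * ∑ i, ∫⁻ x, ‖data i - x‖ₑ ∂(ν i) ≤ ENNReal.ofReal ε' := by
  have : ProperSpace E := FiniteDimensional.proper ℝ E
  obtain ⟨⟨hprob, -, -⟩, hW⟩ := hQ
  have hW' : wasserstein (empirical data) Q < ENNReal.ofReal ε' :=
    hW.trans_lt ((ENNReal.ofReal_lt_ofReal_iff (hε.trans_lt hlt)).2 hlt)
  simp only [wasserstein, iInf_lt_iff] at hW'
  obtain ⟨P, ⟨hP1, hP2⟩, hP⟩ := hW'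
  have : IsProbabilityMeasure P := ⟨by
    have := hprob.measure_univ
    rwa [← hP2, Measure.map_apply measurable_snd MeasurableSet.univ, Set.preimage_univ] at this⟩
  have hfst : P.fst = empirical data := hP1
  -- The first marginal is a sum of point masses, so only the conditional laws at the data points
  -- matter; they serve as the `ν i`. Repeated data points share one law, which is harmless.
  have key : ∀ F : E × E → ℝ≥0∞, Measurable F → ∫⁻ z, F z ∂P =
      (N : ℝ≥0∞)⁻¹ * ∑ i, ∫⁻ x, F (data i, x) ∂(P.condKernel (data i)) := by
    intro F hF
    conv_lhs => rw [← P.disintegrate P.condKernel]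
    rw [Measure.lintegral_compProd hF, hfst]
    simp [empirical, lintegral_finsetSum_measure]
  refine ⟨fun i => P.condKernel (data i), fun i => inferInstance, ?_, ?_⟩
  · ext s hs
    have := key (Set.indicator (Prod.snd ⁻¹' s) 1)
      (measurable_one.indicator (measurable_snd hs))
    rw [lintegral_indicator_one (measurable_snd hs)] at this
    rw [← hP2, Measure.map_apply measurable_snd hs, this]
    simp only [Measure.smul_apply, Measure.coe_finsetSum, Finset.sum_apply, smul_eq_mul]
    congr 1
    refine Finset.sum_congr rfl fun i _ => ?_
    rw [← lintegral_indicator_one hs]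
    rfl
  · rw [← key (fun z => ‖z.1 - z.2‖ₑ) (measurable_fst.sub measurable_snd).enorm]
    exact hP.le

lemma ConvexityAssumption.expectation_le_optimalValue {ℓ : Fin K → E → EReal}
    (hℓ : ConvexityAssumption Ξ ℓ) (hN : 0 < N) (hK : 0 < K) (hdata : ∀ i, data i ∈ Ξ)
    {Q : Measure E} (hQ : Q ∈ ball Ξ data ε) (hε : 0 ≤ ε) (hlt : ε < ε') :
    expectation Q (loss ℓ) ≤ optimalValue Ξ data ε' ℓ := by
  have : ProperSpace E := FiniteDimensional.proper ℝ E
  obtain ⟨ν, hν, hQν, hcost⟩ := exists_decomposition hQ hε hlt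
  obtain ⟨⟨hprob, hsupp, hmom⟩, -⟩ := hQ
  have hN0 : (N : ℝ≥0∞) ≠ 0 := by exact_mod_cast hN.ne'
  have hNi : (N : ℝ≥0∞)⁻¹ ≠ ⊤ := ENNReal.inv_ne_top.2 hN0
  have hNi0 : (N : ℝ≥0∞)⁻¹ ≠ 0 := ENNReal.inv_ne_zero.2 (ENNReal.natCast_ne_top N)
  have hNR : (0 : ℝ) < N := Nat.cast_pos.2 hN
  have hidQ : Integrable (fun x : E => x) Q :=
    ⟨measurable_id.aestronglyMeasurable, hasFiniteIntegral_iff_enorm.2 hmom⟩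
  have hpos : ∫⁻ x, (loss ℓ x).toENNReal ∂Q ≠ ⊤ := by
    have h1 : ∀ x, (loss ℓ x).toENNReal ≤ ∑ k, (ℓ k x).toENNReal := fun x => by
      obtain ⟨k, hk⟩ := exists_eq_loss (ℓ := ℓ) hK x
      rw [← hk]
      exact Finset.single_le_sum (f := fun k => (ℓ k x).toENNReal) (fun _ _ => zero_le)
        (Finset.mem_univ k)
    refine ((lintegral_mono h1).trans_lt ?_).ne
    rw [lintegral_finsetSum _ fun k _ => (hℓ.measurable k).ereal_toENNReal]
    exact ENNReal.sum_lt_top.2 fun k _ => (lintegral_toENNReal_ne_top (hℓ.convex k)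
      (hℓ.isClosed_epigraph k) (hℓ.measurable k) (hℓ.lt_top k) hidQ).lt_top
  by_cases hneg : ∫⁻ x, (-loss ℓ x).toENNReal ∂Q = ⊤
  -- With a finite positive part and an infinite negative part the expectation is `⊥`.
  · rw [expectation, if_neg hpos, hneg, EReal.coe_ennreal_top, EReal.sub_top]
    exact bot_le
  obtain ⟨hae, hint, heq⟩ := expectation_eq_integral hℓ.measurable_loss (hℓ.loss_lt_top hK)
    hpos hneg
  have hac : ∀ i, ν i ≪ Q := fun i s hs => by
    rw [hQν, Measure.smul_apply, smul_eq_mul, mul_eq_zero, or_iff_right hNi0,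
      Measure.coe_finsetSum, Finset.sum_apply, Finset.sum_eq_zero_iff] at hs
    exact hs i (Finset.mem_univ i)
  have hinti : ∀ i, Integrable (fun x => (loss ℓ x).toReal) (ν i) :=
    integrable_of_eq_inv_smul_sum hN hQν hint
  obtain ⟨A, hA, hdisj, hcov, hAℓ⟩ := exists_measurable_partition hK hℓ.measurable
  have hsum : ∀ {f : E → ℝ} i, Integrable f (ν i) →
      ∑ k, ∫ x in A k, f x ∂(ν i) = ∫ x, f x ∂(ν i) := fun i hf => by
    rw [← integral_iUnion_fintype hA hdisj fun k => hf.integrableOn, hcov, setIntegral_univ]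
  let α : Fin N → Fin K → ℝ := fun i k => (ν i).real (A k)
  let ξ : Fin N → Fin K → E := fun i k =>
    if α i k = 0 then data i else ⨍ x in A k, x ∂(ν i)
  have hidi : ∀ i, Integrable (fun x : E => x) (ν i) := integrable_of_eq_inv_smul_sum hN hQν hidQ
  have hdi : ∀ i, Integrable (fun x : E => data i - x) (ν i) := fun i =>
    (integrable_const _).sub (hidi i)
  have hα0 : ∀ {i k}, α i k ≠ 0 → ν i (A k) ≠ 0 := fun h h0 => h (by simp [α, measureReal_def, h0])
  have hfeas : AtomFeasible Ξ data ε' α ξ := by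
    refine ⟨?_, fun i => ?_, fun i k => measureReal_nonneg, fun i k => ?_⟩
    -- Collapsing a cell to its barycenter does not raise the cost: the norm of an integral is at
    -- most the integral of the norm.
    · have h1 : ∀ i k, α i k * ‖data i - ξ i k‖ ≤ ∫ x in A k, ‖data i - x‖ ∂(ν i) := by
        intro i k
        by_cases h0 : α i k = 0
        · rw [h0, zero_mul]
          exact integral_nonneg fun x => norm_nonneg _
        · have h2 : α i k • (data i - ξ i k) = ∫ x in A k, (data i - x) ∂(ν i) := by
            rw [integral_sub (integrable_const _) (hidi i).integrableOn, setIntegral_const]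
            simp only [ξ, if_neg h0, setAverage_eq, smul_sub]
            rw [smul_inv_smul₀ h0]
          have h3 := norm_smul (α i k) (data i - ξ i k)
          rw [Real.norm_of_nonneg measureReal_nonneg, h2] at h3
          rw [← h3]
          exact norm_integral_le_integral_norm _
      have h3 : ∑ i, ∑ k, α i k * ‖data i - ξ i k‖ ≤ ∑ i, ∫ x, ‖data i - x‖ ∂(ν i) :=
        Finset.sum_le_sum fun i _ =>
          (Finset.sum_le_sum fun k _ => h1 i k).trans (hsum i (hdi i).norm).le
      have h4 : ENNReal.ofReal ((1 / (N : ℝ)) * ∑ i, ∫ x, ‖data i - x‖ ∂(ν i)) ≤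
          ENNReal.ofReal ε' := by
        rw [ENNReal.ofReal_mul (by positivity), one_div, ENNReal.ofReal_inv_of_pos hNR,
          ENNReal.ofReal_natCast,
          ENNReal.ofReal_sum_of_nonneg fun i _ => integral_nonneg fun x => norm_nonneg _]
        simpa only [ofReal_integral_norm_eq_lintegral_enorm (hdi _)] using hcost
      exact (mul_le_mul_of_nonneg_left h3 (by positivity)).trans
        ((ENNReal.ofReal_le_ofReal_iff (hε.trans hlt.le)).1 h4)
    · simpa using hsum (f := fun _ => 1) i (integrable_const _)
    · by_cases h0 : α i k = 0
      · simpa only [ξ, if_pos h0] using hdata i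
      · simp only [ξ, if_neg h0]
        refine hℓ.convex_set.set_average_mem hℓ.closed_set (hα0 h0) (measure_ne_top _ _)
          (ae_restrict_of_ae ?_) (hidi i).integrableOn
        exact (hac i).ae_le (mem_ae_iff.2 hsupp)
  have hjensen : ∀ i k, ((∫ x in A k, (loss ℓ x).toReal ∂(ν i) : ℝ) : EReal) ≤
      ((α i k : ℝ) : EReal) * ℓ k (ξ i k) := by
    intro i k
    by_cases h0 : α i k = 0
    · have h1 : ν i (A k) = 0 := (measureReal_eq_zero_iff).1 h0
      rw [Measure.restrict_eq_zero.2 h1, h0]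
      simp
    · have : NeZero ((ν i).restrict (A k)) := ⟨fun h => hα0 h0 (Measure.restrict_eq_zero.1 h)⟩
      rw [← measure_smul_setAverage _ (measure_ne_top _ _), smul_eq_mul, EReal.coe_mul]
      refine mul_le_mul_of_nonneg_left ?_ (EReal.coe_nonneg.2 measureReal_nonneg)
      simp only [ξ, if_neg h0]
      -- The minorant is the real-valued loss, which agrees with `ℓ k` almost everywhere on `A k`.
      refine average_le_of_isConvexFun_neg (hℓ.convex k) (hℓ.isClosed_epigraph k)
        (hidi i).restrict (hinti i).restrict ?_
      filter_upwards [ae_restrict_mem (hA k), ae_restrict_of_ae ((hac i).ae_le hae)] with x hx hx'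
      rw [hx', hAℓ k x hx]
  refine le_trans ?_ (hfeas.le_optimalValue hdata)
  have hQint : ∫ x, (loss ℓ x).toReal ∂Q =
      (1 / (N : ℝ)) * ∑ i, ∑ k, ∫ x in A k, (loss ℓ x).toReal ∂(ν i) := by
    simp only [hsum _ (hinti _)]
    conv_lhs => rw [hQν]
    rw [integral_smul_measure, integral_finsetSum_measure fun i _ => hinti i]
    simp
  rw [heq, hQint, EReal.coe_mul]
  refine mul_le_mul_of_nonneg_left ?_ (EReal.coe_nonneg.2 (by positivity))
  simp only [ereal_coe_sum]
  exact Finset.sum_le_sum fun i _ => Finset.sum_le_sum fun k _ => hjensen i k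

end Decomposition

end WassersteinDRO

end

/-! ### Accumulation points of maximizing sequences are worst-case distributions -/

theorem mainTheorem12 {E : Type*} [NormedAddCommGroup E] [NormedSpace ℝ E]
    [FiniteDimensional ℝ E] [MeasurableSpace E] [BorelSpace E]
    {N K : ℕ} (hN : 0 < N) (hK : 0 < K)
    (Ξ : Set E) (data : Fin N → E) (hdata : ∀ i, data i ∈ Ξ)
    (ε : ℝ) (hε : 0 ≤ ε) (ℓ : Fin K → E → EReal)
    (hℓ : WassersteinDRO.ConvexityAssumption Ξ ℓ)
    (hcase : IsCompact Ξ ∨ K = 1) :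
    (∃ α q, WassersteinDRO.IsMaximizing Ξ data ε ℓ α q) ∧
    ∀ (α : ℕ → Fin N → Fin K → ℝ) (q : ℕ → Fin N → Fin K → E),
      WassersteinDRO.IsMaximizing Ξ data ε ℓ α q →
      (∃ p : (Fin N → Fin K → ℝ) × (Fin N → Fin K → E),
        MapClusterPt p Filter.atTop
          (fun r => (α r, WassersteinDRO.atoms data (α r) (q r)))) ∧
      ∀ (αs : Fin N → Fin K → ℝ) (ξs : Fin N → Fin K → E),
        MapClusterPt (αs, ξs) Filter.atTop
          (fun r => (α r, WassersteinDRO.atoms data (α r) (q r))) →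
        WassersteinDRO.discreteDistribution αs ξs ∈ WassersteinDRO.ball Ξ data ε ∧
        WassersteinDRO.expectation (WassersteinDRO.discreteDistribution αs ξs)
            (WassersteinDRO.loss ℓ) =
          WassersteinDRO.worstCaseExpectation Ξ data ε ℓ := by
  have : ProperSpace E := FiniteDimensional.proper ℝ E
  refine ⟨WassersteinDRO.exists_isMaximizing hK hdata hε ℓ, fun α q hmax =>
    ⟨WassersteinDRO.exists_mapClusterPt_of_atomFeasible hN hcase ε (fun _ => le_rfl)
      fun r => (hmax.1 r).atomFeasible, fun αs ξs hcl => ?_⟩⟩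
  obtain ⟨ψ, hψ, hlim⟩ := hcl.tendsto_subseq
  have ha := (continuous_fst.tendsto _).comp hlim
  have hx := (continuous_snd.tendsto _).comp hlim
  have hfeas : WassersteinDRO.AtomFeasible Ξ data ε αs ξs :=
    WassersteinDRO.AtomFeasible.of_tendsto hℓ.closed_set tendsto_const_nhds
      (fun r => (hmax.1 (ψ r)).atomFeasible) ha hx
  have hball := hfeas.mem_ball hN hℓ.closed_set
  refine ⟨hball, le_antisymm (le_iSup₂_of_le _ hball le_rfl) (iSup₂_le fun Q hQ => ?_)⟩
  calc WassersteinDRO.expectation Q (WassersteinDRO.loss ℓ)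
      ≤ WassersteinDRO.optimalValue Ξ data ε ℓ :=
        WassersteinDRO.le_optimalValue_of_forall hN hdata hℓ hcase fun δ hδ =>
          hℓ.expectation_le_optimalValue hN hK hdata hQ hε (lt_add_of_pos_right ε hδ)
    _ ≤ ((1 / (N : ℝ) : ℝ) : EReal) * WassersteinDRO.weightedLoss ℓ αs ξs :=
        hℓ.le_of_tendsto_weightedLoss (fun r => (hmax.1 (ψ r)).nonneg) ha hx
          (one_div_nonneg.2 (Nat.cast_nonneg N)) (fun _ => le_rfl)
          (hmax.2.comp hψ.tendsto_atTop)
    _ ≤ _ := hfeas.le_expectation hN hK hℓ
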